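/- A \emph{normal map} (crossed module) is a group homomorphism $n\colon M\to G$ together with an action of $G$ on $M$ by automorphisms such that $n({}^g m)=g\,n(m)\,g^{-1}$ and ${}^{n(m)}m'=m\,m'\,m^{-1}$ for all $g\in G$, $m,m'\in M$. The \emph{free normal closure} of a homomorphism $\varphi\colon\Gamma\to G$ is the universal (initial) factorization $\Gamma\to\Gamma^{\varphi}\to G$ of $\varphi$ whose second map is normal. The \emph{normal closures tower} of $\varphi$ is $\cdots\to\Gamma_{i+1}\to\Gamma_i\to\cdots\to\Gamma_1=G$, where $\varphi_1=\varphi$ and $\Gamma\xrightarrow{\varphi_{i+1}}\Gamma_{i+1}\to\Gamma_i$ is the free normal closure of $\varphi_i\colon\Gamma\to\Gamma_i$; put $\Gamma_\infty=\varprojlim\Gamma_i$. For a group $X$ let $X^{(\infty)}$, $\gamma_\infty(X)$ and $Z_\infty(X)$ denote the last terms of the derived series, of the descending central series and of the ascending central series of $X$, when these series terminate. Let $\varphi\colon\Gamma\to G$ be a homomorphism of finite groups such that $G$ is perfect and $G$ is generated by the $G$-conjugates of $\varphi(\Gamma)$, that is, $G=\langle\varphi(\Gamma)^G\rangle$. Let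 $H=\Gamma_\infty$. Then the derived series and the ascending central series of $H$ terminate, the subgroup $H^{(\infty)}$ is perfect, and $H$ is the central product $H=H^{(\infty)}\circ Z_\infty(H)$, i.e. $H=H^{(\infty)}Z_\infty(H)$ and $[H^{(\infty)},Z_\infty(H)]=1$. Moreover, the descending central series of $\Gamma$ terminates, the groups $\Gamma/\gamma_\infty(\Gamma)$ and $Z_\infty(H)$ are nilpotent, and if $\Gamma/\gamma_\infty(\Gamma)$ has nilpotency class $c$, then $Z_\infty(H)$ has nilpotency class at most $c+1$. -/

import Mathlib

universe u v w

/-- A normal map (crossed module) `n : M →* G`, for a given action of `G` on `M` by automorphisms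
(written as a left action). -/
structure IsNormalMap {M : Type u} {G : Type v} [Group M] [Group G] [MulDistribMulAction G M]
    (n : M →* G) : Prop where
  map_smul : ∀ (g : G) (m : M), n (g • m) = g * n m * g⁻¹
  smul_eq_conj : ∀ m m' : M, n m • m' = m * m' * m⁻¹

namespace FreeNormalClosure

section Construction

variable {Γ : Type u} {G : Type v} [Group Γ] [Group G]

/-- The free product of copies `Γ_g` of `Γ`, one for each `g : G`. -/
abbrev Pre (Γ : Type u) (G : Type v) [Group Γ] [Group G] : Type (max u v) :=
  Monoid.CoprodI (fun _ : G => Γ)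

/-- The element `γ` of the copy of `Γ` indexed by `g`. -/
def gen (g : G) : Γ →* Pre Γ G := Monoid.CoprodI.of (M := fun _ : G => Γ) (i := g)

/-- `preMap φ` sends the element `γ` of the `g`-th copy of `Γ` to `g * φ γ * g⁻¹`. -/
def preMap (φ : Γ →* G) : Pre Γ G →* G :=
  Monoid.CoprodI.lift (fun g : G => (MulAut.conj g).toMonoidHom.comp φ)

/-- The action of `h : G` on the free product, taking the `g`-th copy of `Γ` to the `h * g`-th. -/
def preAct (Γ : Type u) {G : Type v} [Group Γ] [Group G] (h : G) : Pre Γ G →* Pre Γ G :=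
  Monoid.CoprodI.lift (fun g : G => gen (h * g))

@[simp] theorem preMap_gen (φ : Γ →* G) (g : G) (c : Γ) :
    preMap φ (gen g c) = g * φ c * g⁻¹ := by
  simp [preMap, gen]

@[simp] theorem preAct_gen (h g : G) (c : Γ) : preAct Γ h (gen g c) = gen (h * g) c := by
  simp [preAct, gen]

theorem pre_hom_ext {N : Type w} [Monoid N] {f f' : Pre Γ G →* N}
    (h : ∀ (g : G) (c : Γ), f (gen g c) = f' (gen g c)) : f = f' :=
  Monoid.CoprodI.ext_hom f f' fun g => MonoidHom.ext fun c => h g c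

theorem preAct_one (x : Pre Γ G) : preAct Γ (1 : G) x = x :=
  DFunLike.congr_fun (pre_hom_ext (f := preAct Γ (1 : G)) (f' := MonoidHom.id _)
    (fun g c => by simp)) x

theorem preAct_mul (h k : G) (x : Pre Γ G) :
    preAct Γ (h * k) x = preAct Γ h (preAct Γ k x) :=
  DFunLike.congr_fun (pre_hom_ext (f := preAct Γ (h * k))
    (f' := (preAct Γ h).comp (preAct Γ k)) (fun g c => by simp [mul_assoc])) x

theorem preMap_preAct (φ : Γ →* G) (h : G) (x : Pre Γ G) :
    preMap φ (preAct Γ h x) = h * preMap φ x * h⁻¹ :=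
  DFunLike.congr_fun (pre_hom_ext (f := (preMap φ).comp (preAct Γ h))
    (f' := (MulAut.conj h).toMonoidHom.comp (preMap φ)) (fun g c => by simp [mul_assoc])) x

/-- The Peiffer subgroup: the normal subgroup that enforces
`x * y * x⁻¹ = (preMap φ x) • y` for all `x`, `y`. -/
def peiffer (φ : Γ →* G) : Subgroup (Pre Γ G) :=
  Subgroup.normalClosure
    {z | ∃ x y : Pre Γ G, z = x * y * x⁻¹ * (preAct Γ (preMap φ x) y)⁻¹}

instance (φ : Γ →* G) : (peiffer φ).Normal := Subgroup.normalClosure_normal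

theorem peiffer_le_ker (φ : Γ →* G) : peiffer φ ≤ (preMap φ).ker := by
  refine Subgroup.normalClosure_le_normal ?_
  rintro z ⟨x, y, rfl⟩
  simp [MonoidHom.mem_ker, preMap_preAct, mul_assoc]

theorem peiffer_le_comap (φ : Γ →* G) (h : G) :
    peiffer φ ≤ (peiffer φ).comap (preAct Γ h) := by
  refine Subgroup.normalClosure_le_normal ?_
  rintro z ⟨x, y, rfl⟩
  refine Subgroup.subset_normalClosure ⟨preAct Γ h x, preAct Γ h y, ?_⟩
  simp [preMap_preAct, ← preAct_mul, mul_assoc]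

end Construction

end FreeNormalClosure

/-- The (free) normal closure `Γ^φ` of a homomorphism `φ : Γ →* G`. -/
def FreeNormalClosure {Γ : Type u} {G : Type v} [Group Γ] [Group G] (φ : Γ →* G) :
    Type (max u v) :=
  FreeNormalClosure.Pre Γ G ⧸ FreeNormalClosure.peiffer φ

namespace FreeNormalClosure

section Structure

variable {Γ : Type u} {G : Type v} [Group Γ] [Group G] (φ : Γ →* G)

instance : Group (FreeNormalClosure φ) :=
  inferInstanceAs (Group (Pre Γ G ⧸ peiffer φ))

/-- The quotient map from the free product. -/
def mk : Pre Γ G →* FreeNormalClosure φ := QuotientGroup.mk' (peiffer φ)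

theorem mk_surjective : Function.Surjective (mk φ) := QuotientGroup.mk'_surjective _

instance : MulDistribMulAction G (FreeNormalClosure φ) where
  smul h := QuotientGroup.map (peiffer φ) (peiffer φ) (preAct Γ h) (peiffer_le_comap φ h)
  one_smul x := by
    obtain ⟨x, rfl⟩ := mk_surjective φ x
    exact congrArg (mk φ) (preAct_one x)
  mul_smul h k x := by
    obtain ⟨x, rfl⟩ := mk_surjective φ x
    exact congrArg (mk φ) (preAct_mul h k x)
  smul_mul h x y :=
    map_mul (QuotientGroup.map (peiffer φ) (peiffer φ) (preAct Γ h) (peiffer_le_comap φ h)) x y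
  smul_one h :=
    map_one (QuotientGroup.map (peiffer φ) (peiffer φ) (preAct Γ h) (peiffer_le_comap φ h))

theorem smul_mk (h : G) (x : Pre Γ G) : h • mk φ x = mk φ (preAct Γ h x) := rfl

/-- The canonical map `c_φ : Γ →* Γ^φ`. -/
def unit : Γ →* FreeNormalClosure φ := (mk φ).comp (gen 1)

/-- The canonical normal map `Γ^φ →* G`. -/
def toBase : FreeNormalClosure φ →* G :=
  QuotientGroup.lift (peiffer φ) (preMap φ) (peiffer_le_ker φ)

theorem toBase_mk (x : Pre Γ G) : toBase φ (mk φ x) = preMap φ x := rfl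

theorem toBase_comp_unit : (toBase φ).comp (unit φ) = φ := by
  ext c
  simp [unit, toBase_mk]

theorem isNormalMap_toBase : IsNormalMap (toBase φ) where
  map_smul g m := by
    obtain ⟨x, rfl⟩ := mk_surjective φ m
    rw [smul_mk, toBase_mk, toBase_mk, preMap_preAct]
  smul_eq_conj m m' := by
    obtain ⟨x, rfl⟩ := mk_surjective φ m
    obtain ⟨y, rfl⟩ := mk_surjective φ m'
    rw [toBase_mk, smul_mk, ← map_inv, ← map_mul, ← map_mul, eq_comm, ← mul_inv_eq_one,
      ← map_inv, ← map_mul]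
    exact (QuotientGroup.eq_one_iff _).2 (Subgroup.subset_normalClosure ⟨x, y, rfl⟩)

/-- `Γ → Γ^φ → G` is the universal factorization of `φ` whose right map is normal: it maps by a
unique normal morphism to any other such factorization `Γ → M → G`. -/
theorem universal {M : Type w} [Group M] [MulDistribMulAction G M] (n : M →* G)
    (hn : IsNormalMap n) (ψ : Γ →* M) (hψ : n.comp ψ = φ) :
    ∃! f : FreeNormalClosure φ →* M,
      (∀ (g : G) (x : FreeNormalClosure φ), f (g • x) = g • f x) ∧
        n.comp f = toBase φ ∧ f.comp (unit φ) = ψ := by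
  let F : Pre Γ G →* M :=
    Monoid.CoprodI.lift (fun g : G => (MulDistribMulAction.toMonoidHom M g).comp ψ)
  have hF : ∀ (g : G) (c : Γ), F (gen g c) = g • ψ c := fun g c => by simp [F, gen]
  have hFs : ∀ (h : G) (x : Pre Γ G), F (preAct Γ h x) = h • F x := fun h x =>
    DFunLike.congr_fun (pre_hom_ext (f := F.comp (preAct Γ h))
      (f' := (MulDistribMulAction.toMonoidHom M h).comp F)
      (fun g c => by simp [hF, mul_smul])) x
  have hnF : ∀ x : Pre Γ G, n (F x) = preMap φ x := fun x =>
    DFunLike.congr_fun (pre_hom_ext (f := n.comp F) (f' := preMap φ)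
      (fun g c => by simp [hF, hn.map_smul, ← hψ])) x
  have hk : peiffer φ ≤ F.ker := by
    refine Subgroup.normalClosure_le_normal ?_
    rintro z ⟨x, y, rfl⟩
    simp only [SetLike.mem_coe, MonoidHom.mem_ker, map_mul, map_inv, hFs]
    rw [← hnF, hn.smul_eq_conj, mul_inv_cancel]
  refine ⟨QuotientGroup.lift (peiffer φ) F hk, ⟨?_, ?_, ?_⟩, ?_⟩
  · intro g x
    obtain ⟨x, rfl⟩ := mk_surjective φ x
    exact hFs g x
  · ext x
    obtain ⟨x, rfl⟩ := mk_surjective φ x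
    exact hnF x
  · ext c
    exact (hF 1 c).trans (one_smul _ _)
  · rintro f ⟨h1, -, h3⟩
    have : f.comp (mk φ) = F := pre_hom_ext fun g c => by
      have := preAct_gen g 1 c
      rw [mul_one] at this
      rw [hF, ← this, MonoidHom.comp_apply, ← smul_mk, h1, ← h3]
      rfl
    ext x
    obtain ⟨x, rfl⟩ := mk_surjective φ x
    exact DFunLike.congr_fun this x

end Structure

end FreeNormalClosure

/-- A group together with a homomorphism from `Γ`. -/
structure GroupUnder (Γ : Type u) [Group Γ] where
  carrier : Type u
  [group : Group carrier]
  hom : Γ →* carrier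

attribute [instance] GroupUnder.group

/-- The normal closures tower of `φ`. The indices start at `0`, so that `normalTower φ i` is
`Γ_{i+1}` with its map `φ_{i+1}` from `Γ`, in the indexing where `Γ_1 = G` and `φ_1 = φ`. -/
def normalTower {Γ G : Type u} [Group Γ] [Group G] (φ : Γ →* G) : ℕ → GroupUnder Γ
  | 0 => ⟨G, φ⟩
  | i + 1 => ⟨FreeNormalClosure (normalTower φ i).hom, FreeNormalClosure.unit (normalTower φ i).hom⟩

/-- The normal map from each member of the normal closures tower to the preceding one. -/
def normalTowerMap {Γ G : Type u} [Group Γ] [Group G] (φ : Γ →* G) (i : ℕ) :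
    (normalTower φ (i + 1)).carrier →* (normalTower φ i).carrier :=
  FreeNormalClosure.toBase (normalTower φ i).hom

/-- `Γ_∞`, the inverse limit of the normal closures tower of `φ`, as the group of compatible
sequences. -/
def normalTowerLimit {Γ G : Type u} [Group Γ] [Group G] (φ : Γ →* G) :
    Subgroup ((i : ℕ) → (normalTower φ i).carrier) where
  carrier := {x | ∀ i, normalTowerMap φ i (x (i + 1)) = x i}
  one_mem' i := by simp
  mul_mem' hx hy i := by simp [hx i, hy i]
  inv_mem' hx i := by simp [hx i]

/-- A series of subgroups terminates at `T`: all its members from some point on equal `T`. -/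
def TerminatesAt {H : Type u} [Group H] (S : ℕ → Subgroup H) (T : Subgroup H) : Prop :=
  ∃ t, ∀ n, t ≤ n → S n = T

/-- `H^(∞)`, the intersection (the last term, if there is one) of the derived series. -/
def perfectCore (H : Type u) [Group H] : Subgroup H := ⨅ n, derivedSeries H n

/-- `Z_∞(H)`, the union (the last term, if there is one) of the ascending central series. -/
def hypercenter (H : Type u) [Group H] : Subgroup H := ⨆ n, Subgroup.upperCentralSeries H n

/-- `γ_∞(H)`, the intersection (the last term, if there is one) of the descending central
series. -/
def gammaInfty (H : Type u) [Group H] : Subgroup H :=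
  ⨅ n, Subgroup.lowerCentralSeries (⊤ : Subgroup H) n

instance (H : Type u) [Group H] : (gammaInfty H).Normal :=
  Subgroup.normal_iInf_normal fun _ => inferInstance

/-- `H` is the (internal) central product of its subgroups `A` and `B`. -/
def IsCentralProduct {H : Type u} [Group H] (A B : Subgroup H) : Prop :=
  A ⊔ B = ⊤ ∧ ∀ a ∈ A, ∀ b ∈ B, a * b = b * a

/-! Each map of the tower is a surjection with central kernel, so every `Γ_i` is normally generated
by the image of `Γ` and is a hypercentral extension of `G` (`IsHypercentralOver`). Let `E` be a
finite such group and `P` its perfect core. As `G` is perfect, `P` maps onto `G`, whence `E = P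
Z_n(E)` for some `n`; by the three subgroups lemma `P` centralizes `Z_∞(E)`. This is the central
product.

The quotient `E/P` is an image of `Z_n(E)`, hence nilpotent, and there normal generation by `Γ`
means that `Γ` maps onto it (`surjective_quotient_perfectCore`). So `E/P` is an image of `Γ/γ_∞(Γ)`;
since `P ∩ Z_∞(E)` is central in `Z_∞(E)`, the class of `Z_∞(E)` is at most `c + 1`.

Finally `|E/P| ≤ |Γ|`, and `|P|` is bounded in terms of `|G|` by Schur's theorem, `P` being perfect
and central over `G`. The orders `|Γ_i|` are therefore bounded (`card_le`), the tower stabilizes,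
and `Γ_∞` is one of the groups `E`. -/

open Subgroup
open scoped commutatorElement

/-! ### Derived and central series, perfect subgroups. -/

section SeriesOfSubgroups

variable {H : Type u} [Group H]

theorem TerminatesAt.iInf_of_antitone [Finite H] {S : ℕ → Subgroup H} (hS : Antitone S) :
    TerminatesAt S (⨅ n, S n) := by
  obtain ⟨t, ht⟩ := WellFoundedLT.antitone_chain_condition hS
  refine ⟨t, fun n hn => le_antisymm (le_iInf fun m => ?_) (iInf_le S n)⟩
  rw [← ht n hn, ht (max t m) (le_max_left t m)]
  exact hS (le_max_right t m)

theorem TerminatesAt.iSup_of_monotone [Finite H] {S : ℕ → Subgroup H} (hS : Monotone S) :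
    TerminatesAt S (⨆ n, S n) := by
  obtain ⟨t, ht⟩ := WellFoundedGT.monotone_chain_condition ⟨S, hS⟩
  replace ht : ∀ n, t ≤ n → S t = S n := ht
  refine ⟨t, fun n hn => le_antisymm (le_iSup S n) (iSup_le fun m => ?_)⟩
  rw [← ht n hn, ht (max t m) (le_max_left t m)]
  exact hS (le_max_right t m)

instance perfectCore_normal : (perfectCore H).Normal :=
  Subgroup.normal_iInf_normal fun n => derivedSeries_normal H n

theorem perfectCore_isPerfect [Finite H] : Group.IsPerfect (perfectCore H) := by
  obtain ⟨t, ht⟩ := TerminatesAt.iInf_of_antitone (derivedSeries_antitone H)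
  have h0 : derivedSeries H t = perfectCore H := ht t le_rfl
  have h1 : derivedSeries H (t + 1) = perfectCore H := ht (t + 1) t.le_succ
  rw [Subgroup.isPerfect_iff]
  rwa [derivedSeries_succ, h0] at h1

/-- A surjection carries each derived term onto the corresponding derived term of `G`, which is all
of `G`. -/
theorem perfectCore_sup_ker {G : Type v} [Group G] [Finite H] [Group.IsPerfect G] {p : H →* G}
    (hp : Function.Surjective p) : perfectCore H ⊔ p.ker = ⊤ := by
  obtain ⟨t, ht⟩ := TerminatesAt.iInf_of_antitone (derivedSeries_antitone H)
  have h0 : derivedSeries H t = perfectCore H := ht t le_rfl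
  rw [← h0, ← Subgroup.comap_map_eq, map_derivedSeries_eq hp, Group.IsPerfect.derivedSeries_eq_top,
    Subgroup.comap_top]

/-- A perfect subgroup centralizes the ascending central series. -/
theorem commutator_upperCentralSeries_eq_bot (P : Subgroup H) [Group.IsPerfect P] (n : ℕ) :
    ⁅P, Subgroup.upperCentralSeries H n⁆ = ⊥ := by
  induction n with
  | zero => simp
  | succ n ih =>
    have hle : ⁅Subgroup.upperCentralSeries H (n + 1), P⁆ ≤ Subgroup.upperCentralSeries H n :=
      (commutator_mono le_rfl le_top).trans (Subgroup.commutator_upperCentralSeries_top_le H n)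
    have h1 : ⁅⁅Subgroup.upperCentralSeries H (n + 1), P⁆, P⁆ = ⊥ := by
      rw [eq_bot_iff, ← ih, commutator_comm P]
      exact commutator_mono hle le_rfl
    have h2 : ⁅⁅P, Subgroup.upperCentralSeries H (n + 1)⁆, P⁆ = ⊥ := by
      rwa [commutator_comm P]
    -- Three subgroups lemma: `⁅⁅P, P⁆, Z_{n+1}⁆ = 1`, and `⁅P, P⁆ = P`.
    have h3 := commutator_commutator_eq_bot_of_rotate h2 h1
    rwa [Subgroup.commutator_eq_self] at h3

theorem commute_of_mem_perfect_of_mem_upperCentralSeries (P : Subgroup H) [Group.IsPerfect P]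
    {n : ℕ} {a b : H} (ha : a ∈ P) (hb : b ∈ Subgroup.upperCentralSeries H n) : a * b = b * a := by
  have h := commutator_mem_commutator ha hb
  rw [commutator_upperCentralSeries_eq_bot, mem_bot] at h
  exact commutatorElement_eq_one_iff_mul_comm.1 h

theorem comap_upperCentralSeries_le_succ {G : Type v} [Group G] {f : H →* G}
    (hf : f.ker ≤ center H) (n : ℕ) :
    (Subgroup.upperCentralSeries G n).comap f ≤ Subgroup.upperCentralSeries H (n + 1) := by
  induction n with
  | zero =>
    rw [Subgroup.upperCentralSeries_zero, MonoidHom.comap_bot, zero_add, Subgroup.upperCentralSeries_one]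
    exact hf
  | succ n ih =>
    intro x hx
    rw [Subgroup.mem_upperCentralSeries_succ_iff]
    intro y
    apply ih
    have := Subgroup.mem_upperCentralSeries_succ_iff.1 (mem_comap.1 hx) (f y)
    simpa using this

end SeriesOfSubgroups

/-! ### Normal generation and finiteness of central extensions. -/

section NormalGeneration

variable {Γ : Type u} {E : Type v} [Group Γ] [Group E]

/-- A subgroup of a finite nilpotent group whose normal closure is everything is everything. -/
theorem eq_top_of_normalClosure_eq_top_of_isNilpotent [Finite E] [Group.IsNilpotent E]
    {K : Subgroup E} (hK : normalClosure (K : Set E) = ⊤) : K = ⊤ := by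
  -- A proper `K` would lie in a maximal subgroup, which is normal by nilpotency and so contains the
  -- normal closure of `K`.
  refine (eq_top_or_exists_le_coatom K).resolve_right ?_
  rintro ⟨M, hM, hKM⟩
  have : M.Normal := NormalizerCondition.normal_of_coatom M Group.normalizerCondition_of_isNilpotent hM
  exact hM.1 (eq_top_iff.2 (hK ▸ normalClosure_le_normal hKM))

theorem normalClosure_range_comp_eq_top {F : Type w} [Group F] {ψ : Γ →* E}
    (hψ : normalClosure (Set.range ψ) = ⊤) {f : E →* F} (hf : Function.Surjective f) :
    normalClosure (Set.range (f.comp ψ)) = ⊤ := by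
  rw [MonoidHom.coe_comp, Set.range_comp, ← map_normalClosure _ f hf, hψ,
    map_top_of_surjective f hf]

/-- Central factors do not affect a commutator, so `⁅a, b⁆` depends only on `f a` and `f b`;
`Function.invFun f` picks the representatives. -/
theorem finite_commutatorSet_of_ker_le_center {G : Type w} [Group G] [Finite G] {f : E →* G}
    (hf : f.ker ≤ center E) :
    Finite (commutatorSet E) ∧ Nat.card (commutatorSet E) ≤ Nat.card G ^ 2 := by
  let s : G × G → E := fun x => ⁅Function.invFun f x.1, Function.invFun f x.2⁆
  have hs : ∀ a : E, ∃ z ∈ center E, a = Function.invFun f (f a) * z := fun a =>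
    ⟨(Function.invFun f (f a))⁻¹ * a, hf (by
      rw [MonoidHom.mem_ker, map_mul, map_inv, Function.invFun_eq (f := f) ⟨a, rfl⟩, inv_mul_cancel]),
      by group⟩
  have hsub : commutatorSet E ⊆ Set.range s := by
    rintro _ ⟨a, b, rfl⟩
    refine ⟨(f a, f b), ?_⟩
    obtain ⟨z, hz, ha⟩ := hs a
    obtain ⟨w, hw, hb⟩ := hs b
    simp only [s]
    generalize Function.invFun f (f a) = a' at ha ⊢
    generalize Function.invFun f (f b) = b' at hb ⊢
    subst ha hb
    have hz' := mem_center_iff.1 hz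
    have hw' := mem_center_iff.1 hw
    simp only [commutatorElement_def, mul_inv_rev]
    calc a' * b' * a'⁻¹ * b'⁻¹ = a' * b' * (z * z⁻¹) * a'⁻¹ * (w * w⁻¹) * b'⁻¹ := by group
      _ = a' * (b' * z) * z⁻¹ * (a'⁻¹ * w) * w⁻¹ * b'⁻¹ := by group
      _ = a' * z * b' * (z⁻¹ * w) * a'⁻¹ * w⁻¹ * b'⁻¹ := by rw [hz', hw']; group
      _ = a' * z * (b' * w) * (z⁻¹ * a'⁻¹) * (w⁻¹ * b'⁻¹) := by rw [hw']; group
  refine ⟨Finite.Set.subset _ hsub, ?_⟩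
  calc Nat.card (commutatorSet E) ≤ Nat.card (Set.range s) :=
        Nat.card_mono (Set.toFinite _) hsub
    _ ≤ Nat.card (G × G) := Nat.card_le_card_of_surjective _ Set.rangeFactorization_surjective
    _ = Nat.card G ^ 2 := by rw [Nat.card_prod, sq]

/-- A bound for the order of a perfect central extension of a group of order `g`. -/
def perfectCentralExtensionBound (g : ℕ) : ℕ :=
  (Finset.range (g ^ 2 + 1)).sup cardCommutatorBound

/-- Schur's theorem bounds the commutator subgroup, here all of `E`, by the number of commutators.
That number is only known to be at most `g ^ 2`, hence the supremum in the bound. -/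
theorem card_le_of_isPerfect_of_ker_le_center {G : Type w} [Group G] [Finite G]
    [Group.IsPerfect E] {f : E →* G} (hf : f.ker ≤ center E) :
    Nat.card E ≤ perfectCentralExtensionBound (Nat.card G) := by
  obtain ⟨hfin, hcard⟩ := finite_commutatorSet_of_ker_le_center hf
  have h := card_commutator_le_of_finite_commutatorSet E
  rw [Group.IsPerfect.commutator_eq_top, card_top] at h
  exact h.trans (Finset.le_sup (f := cardCommutatorBound)
    (Finset.mem_range.2 (Nat.lt_succ_of_le hcard)))

/-- A group that is normally generated by the image of a finite group and that is a central
extension of a finite group is finite. -/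
theorem finite_of_ker_le_center {G : Type w} [Group G] [Finite G] [Finite Γ] {ψ : Γ →* E}
    (hψ : normalClosure (Set.range ψ) = ⊤) {f : E →* G} (hf : f.ker ≤ center E) : Finite E := by
  have := (finite_commutatorSet_of_ker_le_center hf).1
  have htop := normalClosure_range_comp_eq_top hψ
    (f := (Abelianization.of : E →* Abelianization E)) (QuotientGroup.mk'_surjective _)
  -- In an abelian group the image of `Γ` is already normal.
  have hsurj : Function.Surjective ((Abelianization.of : E →* Abelianization E).comp ψ) := by
    rw [← MonoidHom.range_eq_top, eq_top_iff, ← htop]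
    exact normalClosure_le_normal (MonoidHom.coe_range _).ge
  have : Finite (E ⧸ _root_.commutator E) := Finite.of_surjective _ hsurj
  exact Finite.of_equiv _ (groupEquivQuotientProdSubgroup (s := _root_.commutator E)).symm

end NormalGeneration

/-- `ψ : Γ →* E` normally generates `E`, and `E` is a hypercentral extension of `G`. -/
structure IsHypercentralOver {Γ : Type u} {E : Type v} [Group Γ] [Group E] (ψ : Γ →* E)
    (G : Type w) [Group G] : Prop where
  normalClosure_range : normalClosure (Set.range ψ) = ⊤
  exists_hom : ∃ (p : E →* G) (n : ℕ), Function.Surjective p ∧ p.ker ≤ Subgroup.upperCentralSeries E n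

/-! ### Structure of finite hypercentral extensions of a perfect group. -/

namespace IsHypercentralOver

variable {Γ : Type u} {E : Type v} {G : Type w} [Group Γ] [Group E] [Group G] {ψ : Γ →* E}

/-- Passage to a central extension. -/
theorem of_ker_le_center {F : Type*} [Group F] {f : F →* E} (hf : Function.Surjective f)
    (hker : f.ker ≤ center F) {χ : Γ →* F} (hχ : normalClosure (Set.range χ) = ⊤)
    (h : IsHypercentralOver ψ G) : IsHypercentralOver χ G := by
  obtain ⟨p, n, hp, hpn⟩ := h.exists_hom
  refine ⟨hχ, p.comp f, n + 1, hp.comp hf, ?_⟩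
  rw [← MonoidHom.comap_ker]
  exact (comap_mono hpn).trans (comap_upperCentralSeries_le_succ hker n)

variable [Finite E] [Group.IsPerfect G]

theorem exists_perfectCore_sup_upperCentralSeries (h : IsHypercentralOver ψ G) :
    ∃ n, perfectCore E ⊔ Subgroup.upperCentralSeries E n = ⊤ := by
  obtain ⟨p, n, hp, hpn⟩ := h.exists_hom
  exact ⟨n, eq_top_iff.2 ((perfectCore_sup_ker hp).ge.trans (sup_le_sup_left hpn _))⟩

theorem isNilpotent_quotient_perfectCore (h : IsHypercentralOver ψ G) :
    Group.IsNilpotent (E ⧸ perfectCore E) := by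
  obtain ⟨n, hn⟩ := h.exists_perfectCore_sup_upperCentralSeries
  have hs := QuotientGroup.mk'_surjective (perfectCore E)
  refine ⟨n, eq_top_iff.2 ?_⟩
  -- The image of `Z_n(E)` is the whole quotient, because `E = P Z_n(E)` and `P` dies.
  refine le_trans ?_ (Subgroup.upperCentralSeries.map hs n)
  rw [← map_top_of_surjective _ hs, ← hn, Subgroup.map_sup, QuotientGroup.map_mk'_self, bot_sup_eq]

theorem surjective_quotient_perfectCore (h : IsHypercentralOver ψ G) :
    Function.Surjective ((QuotientGroup.mk' (perfectCore E)).comp ψ) := by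
  have := h.isNilpotent_quotient_perfectCore
  rw [← MonoidHom.range_eq_top]
  apply eq_top_of_normalClosure_eq_top_of_isNilpotent
  rw [MonoidHom.coe_range]
  exact normalClosure_range_comp_eq_top h.normalClosure_range (QuotientGroup.mk'_surjective _)

theorem card_le [Finite Γ] [Finite G] (h : IsHypercentralOver ψ G) :
    Nat.card E ≤ Nat.card Γ * perfectCentralExtensionBound (Nat.card G) := by
  obtain ⟨p, n, hp, hpn⟩ := h.exists_hom
  have hperf := perfectCore_isPerfect (H := E)
  rw [card_eq_card_quotient_mul_card_subgroup (perfectCore E)]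
  refine Nat.mul_le_mul (Nat.card_le_card_of_surjective _ h.surjective_quotient_perfectCore)
    -- The kernel of `P → G` lies in `Z_n(E)`, which the perfect group `P` centralizes.
    (card_le_of_isPerfect_of_ker_le_center (f := p.comp (perfectCore E).subtype) ?_)
  intro x hx
  rw [mem_center_iff]
  intro y
  exact Subtype.ext (commute_of_mem_perfect_of_mem_upperCentralSeries (perfectCore E) y.2
    (hpn (MonoidHom.mem_ker.2 (MonoidHom.mem_ker.1 hx))))

theorem isCentralProduct (h : IsHypercentralOver ψ G) :
    IsCentralProduct (perfectCore E) (hypercenter E) := by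
  have hperf := perfectCore_isPerfect (H := E)
  obtain ⟨n, hn⟩ := h.exists_perfectCore_sup_upperCentralSeries
  refine ⟨eq_top_iff.2 (hn.ge.trans (sup_le_sup_left (le_iSup _ n) _)), fun a ha b hb => ?_⟩
  obtain ⟨t, ht⟩ := TerminatesAt.iSup_of_monotone (Subgroup.upperCentralSeries_mono E)
  rw [hypercenter, ← ht t le_rfl] at hb
  exact commute_of_mem_perfect_of_mem_upperCentralSeries _ ha hb

theorem ker_quotient_perfectCore_le_center (h : IsHypercentralOver ψ G) :
    ((QuotientGroup.mk' (perfectCore E)).comp (hypercenter E).subtype).ker ≤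
      center (hypercenter E) := by
  intro x hx
  rw [← MonoidHom.comap_ker, QuotientGroup.ker_mk', mem_comap] at hx
  rw [mem_center_iff]
  exact fun y => Subtype.ext (h.isCentralProduct.2 _ hx _ y.2).symm

theorem isNilpotent_hypercenter (h : IsHypercentralOver ψ G) :
    Group.IsNilpotent (hypercenter E) :=
  have := h.isNilpotent_quotient_perfectCore
  Subgroup.isNilpotent_of_ker_le_center _ h.ker_quotient_perfectCore_le_center

theorem nilpotencyClass_hypercenter_le (h : IsHypercentralOver ψ G)
    [Group.IsNilpotent (Γ ⧸ gammaInfty Γ)] :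
    Group.nilpotencyClass (hypercenter E) ≤ Group.nilpotencyClass (Γ ⧸ gammaInfty Γ) + 1 := by
  have hnil := h.isNilpotent_quotient_perfectCore
  refine (Group.nilpotencyClass_le_of_ker_le_center _
    h.ker_quotient_perfectCore_le_center).trans (Nat.add_le_add_right ?_ 1)
  -- A homomorphism from `Γ` to a nilpotent group kills some term of the descending central series.
  have hker : gammaInfty Γ ≤ ((QuotientGroup.mk' (perfectCore E)).comp ψ).ker := by
    obtain ⟨n, hn⟩ := Subgroup.nilpotent_iff_lowerCentralSeries.1 hnil
    refine (iInf_le _ n).trans ?_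
    rw [← MonoidHom.comap_bot, ← map_le_iff_le_comap, ← hn]
    rw [Subgroup.map_lowerCentralSeries]
    exact Subgroup.lowerCentralSeries_mono n le_top
  refine Group.nilpotencyClass_le_of_surjective (QuotientGroup.lift _ _ hker) ?_
  exact QuotientGroup.lift_surjective_of_surjective _ _ h.surjective_quotient_perfectCore hker

end IsHypercentralOver

theorem isNilpotent_quotient_gammaInfty (Γ : Type u) [Group Γ] [Finite Γ] :
    Group.IsNilpotent (Γ ⧸ gammaInfty Γ) := by
  obtain ⟨t, ht⟩ := TerminatesAt.iInf_of_antitone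
    (Subgroup.lowerCentralSeries_antitone (S := (⊤ : Subgroup Γ)))
  have h0 : Subgroup.lowerCentralSeries (⊤ : Subgroup Γ) t = gammaInfty Γ := ht t le_rfl
  refine Subgroup.nilpotent_iff_lowerCentralSeries.2 ⟨t, ?_⟩
  rw [← map_top_of_surjective _ (QuotientGroup.mk'_surjective (gammaInfty Γ)),
    ← Subgroup.map_lowerCentralSeries, h0, QuotientGroup.map_mk'_self]

/-! ### One step of the tower is a central extension. -/

namespace FreeNormalClosure

variable {Γ : Type u} {G : Type v} [Group Γ] [Group G] (φ : Γ →* G)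

theorem toBase_surjective (hφ : normalClosure (Set.range φ) = ⊤) :
    Function.Surjective (toBase φ) := by
  rw [← MonoidHom.range_eq_top, eq_top_iff, ← hφ, normalClosure, closure_le]
  intro x hx
  obtain ⟨_, ⟨c, rfl⟩, hx⟩ := Group.mem_conjugatesOfSet_iff.1 hx
  obtain ⟨g, rfl⟩ := isConj_iff.1 hx
  exact ⟨mk φ (gen g c), by rw [toBase_mk, preMap_gen]⟩

/-- An element over `1` acts trivially, yet acts by conjugation. -/
theorem ker_toBase_le_center : (toBase φ).ker ≤ center (FreeNormalClosure φ) := by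
  intro x hx
  rw [mem_center_iff]
  intro y
  have h := (isNormalMap_toBase φ).smul_eq_conj x y
  rw [MonoidHom.mem_ker.1 hx, one_smul, eq_mul_inv_iff_mul_eq] at h
  exact h

theorem normalClosure_range_unit (hφ : normalClosure (Set.range φ) = ⊤) :
    normalClosure (Set.range (unit φ)) = ⊤ := by
  have hN : (normalClosure (Set.range (unit φ))).Normal := inferInstance
  have hgen : ∀ g c, mk φ (gen g c) ∈ normalClosure (Set.range (unit φ)) := by
    intro g c
    -- With `g` lifted to `x`, the `g`-th copy of `Γ` is the conjugate by `x` of the copy at `1`,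
    -- the image of `unit φ`.
    obtain ⟨x, rfl⟩ := toBase_surjective φ hφ g
    have hx : mk φ (gen (toBase φ x) c) = x * unit φ c * x⁻¹ := by
      rw [← (isNormalMap_toBase φ).smul_eq_conj, unit, MonoidHom.comp_apply, smul_mk, preAct_gen,
        mul_one]
    rw [hx]
    exact hN.conj_mem _ (subset_normalClosure ⟨c, rfl⟩) x
  have hq : (QuotientGroup.mk' (normalClosure (Set.range (unit φ)))).comp (mk φ) = 1 :=
    pre_hom_ext fun g c => (QuotientGroup.eq_one_iff _).2 (hgen g c)
  refine eq_top_iff.2 fun x _ => ?_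
  obtain ⟨x, rfl⟩ := mk_surjective φ x
  exact (QuotientGroup.eq_one_iff _).1 (DFunLike.congr_fun hq x)

end FreeNormalClosure

/-! ### Stabilization of the tower and its limit. -/

section NormalTower

variable {Γ G : Type u} [Group Γ] [Group G] {φ : Γ →* G}

theorem normalTower_isHypercentralOver (hφ : normalClosure (Set.range φ) = ⊤) (i : ℕ) :
    IsHypercentralOver (normalTower φ i).hom G := by
  induction i with
  | zero => exact ⟨hφ, MonoidHom.id G, 0, Function.surjective_id, fun x hx => hx⟩
  | succ i ih =>
    exact ih.of_ker_le_center (FreeNormalClosure.toBase_surjective _ ih.normalClosure_range)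
      (FreeNormalClosure.ker_toBase_le_center _)
      (FreeNormalClosure.normalClosure_range_unit _ ih.normalClosure_range)

/-- Finiteness is needed level by level first, since the uniform bound `card_le` presupposes it. -/
theorem normalTower_finite [Finite Γ] [Finite G] (hφ : normalClosure (Set.range φ) = ⊤) (i : ℕ) :
    Finite (normalTower φ i).carrier := by
  induction i with
  | zero => exact ‹Finite G›
  | succ i ih =>
    exact finite_of_ker_le_center
      (normalTower_isHypercentralOver hφ (i + 1)).normalClosure_range
      (FreeNormalClosure.ker_toBase_le_center (normalTower φ i).hom)

theorem normalTowerMap_surjective (hφ : normalClosure (Set.range φ) = ⊤) (i : ℕ) :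
    Function.Surjective (normalTowerMap φ i) :=
  FreeNormalClosure.toBase_surjective _ (normalTower_isHypercentralOver hφ i).normalClosure_range

/-- The normal closures tower stabilizes. -/
theorem exists_normalTowerMap_bijective [Finite Γ] [Finite G] [Group.IsPerfect G]
    (hφ : normalClosure (Set.range φ) = ⊤) :
    ∃ t, ∀ i, t ≤ i → Function.Bijective (normalTowerMap φ i) := by
  have hfin := normalTower_finite hφ
  let a : ℕ → ℕ := fun i => Nat.card (normalTower φ i).carrier
  have hmono : Monotone a := monotone_nat_of_le_succ fun i =>
    Nat.card_le_card_of_surjective _ (normalTowerMap_surjective hφ i)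
  obtain ⟨t, ht⟩ : ∃ t, ∀ i, t ≤ i → a i = a t := by
    have hbdd : BddAbove (Set.range a) :=
      ⟨Nat.card Γ * perfectCentralExtensionBound (Nat.card G), by
        rintro _ ⟨i, rfl⟩
        exact (normalTower_isHypercentralOver hφ i).card_le⟩
    obtain ⟨t, ht⟩ := Nat.sSup_mem (Set.range_nonempty a) hbdd
    exact ⟨t, fun i hi => le_antisymm (ht ▸ le_csSup hbdd ⟨i, rfl⟩) (hmono hi)⟩
  refine ⟨t, fun i hi => (Nat.bijective_iff_surjective_and_card _).2
    ⟨normalTowerMap_surjective hφ i, ?_⟩⟩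
  exact (ht (i + 1) (hi.trans i.le_succ)).trans (ht i hi).symm

/-- The projection of the limit to a member of the tower. -/
def normalTowerProj (φ : Γ →* G) (i : ℕ) : normalTowerLimit φ →* (normalTower φ i).carrier :=
  (Pi.evalMonoidHom (fun i => (normalTower φ i).carrier) i).comp (normalTowerLimit φ).subtype

theorem normalTowerProj_succ (i : ℕ) (x : normalTowerLimit φ) :
    normalTowerMap φ i (normalTowerProj φ (i + 1) x) = normalTowerProj φ i x :=
  x.2 i

/-- The entry at `t` determines the later ones by injectivity of the maps, and the earlier ones by
compatibility. -/
theorem normalTowerProj_injective {t : ℕ}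
    (ht : ∀ i, t ≤ i → Function.Bijective (normalTowerMap φ i)) :
    Function.Injective (normalTowerProj φ t) := by
  intro x y hxy
  have hup : ∀ i, t ≤ i → normalTowerProj φ i x = normalTowerProj φ i y := by
    intro i hi
    induction i, hi using Nat.le_induction with
    | base => exact hxy
    | succ i hi ih =>
      apply (ht i hi).1
      rw [normalTowerProj_succ, normalTowerProj_succ, ih]
  have hdown : ∀ k i, normalTowerProj φ (i + k) x = normalTowerProj φ (i + k) y →
      normalTowerProj φ i x = normalTowerProj φ i y := by
    intro k
    induction k with
    | zero => exact fun i h => h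
    | succ k ih =>
      intro i h
      apply ih
      rw [← normalTowerProj_succ (i + k) x, ← normalTowerProj_succ (i + k) y]
      exact congrArg (normalTowerMap φ (i + k)) h
  exact Subtype.ext (funext fun i => hdown t i (hup (i + t) (Nat.le_add_left t i)))

theorem normalTowerProj_surjective (hφ : normalClosure (Set.range φ) = ⊤) (t : ℕ) :
    Function.Surjective (normalTowerProj φ t) := by
  have hpartial : ∀ (t : ℕ) (y : (normalTower φ t).carrier),
      ∃ x : (i : ℕ) → (normalTower φ i).carrier,
        (∀ i < t, normalTowerMap φ i (x (i + 1)) = x i) ∧ x t = y := by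
    intro t
    induction t with
    | zero => exact fun y => ⟨Function.update 1 0 y, by simp, by simp⟩
    | succ t ih =>
      intro y
      obtain ⟨x, hx, hxt⟩ := ih (normalTowerMap φ t y)
      refine ⟨Function.update x (t + 1) y, fun i hi => ?_, Function.update_self ..⟩
      rw [Function.update_of_ne (by lia : i ≠ t + 1)]
      rcases Nat.lt_succ_iff_lt_or_eq.1 hi with hi | rfl
      · rw [Function.update_of_ne (by lia), hx i hi]
      · rw [Function.update_self, hxt]
  choose s hs using normalTowerMap_surjective hφ
  intro y
  obtain ⟨x, hx, rfl⟩ := hpartial t y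
  -- The entries of `x` beyond `t` are arbitrary; `z` replaces them by successive lifts through the
  -- sections `s`.
  let z : (i : ℕ) → (normalTower φ i).carrier :=
    fun i => Nat.rec (x 0) (fun i a => if i + 1 ≤ t then x (i + 1) else s i a) i
  have hz : ∀ i, z (i + 1) = if i + 1 ≤ t then x (i + 1) else s i (z i) := fun i => rfl
  have hzx : ∀ i ≤ t, z i = x i := by
    rintro (_ | i) hi
    · rfl
    · rw [hz, if_pos hi]
  refine ⟨⟨z, fun i => ?_⟩, hzx t le_rfl⟩
  rw [hz]
  split_ifs with hi
  · rw [hx i hi, hzx i (Nat.le_of_succ_le hi)]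
  · exact hs i (z i)

theorem normalTowerLimit_isHypercentralOver [Finite Γ] [Finite G] [Group.IsPerfect G]
    (hφ : normalClosure (Set.range φ) = ⊤) :
    Finite (normalTowerLimit φ) ∧ ∃ ψ : Γ →* normalTowerLimit φ, IsHypercentralOver ψ G := by
  obtain ⟨t, ht⟩ := exists_normalTowerMap_bijective hφ
  have hinj := normalTowerProj_injective ht
  have hsurj := normalTowerProj_surjective hφ t
  have hfin := normalTower_finite hφ t
  have htower := normalTower_isHypercentralOver hφ t
  let e := MulEquiv.ofBijective (normalTowerProj φ t) ⟨hinj, hsurj⟩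
  refine ⟨Finite.of_injective _ hinj, e.symm.toMonoidHom.comp (normalTower φ t).hom, ?_⟩
  -- The isomorphism `Γ_∞ → Γ_t` counts as a central extension with trivial kernel.
  refine htower.of_ker_le_center hsurj ?_
    (normalClosure_range_comp_eq_top htower.normalClosure_range e.symm.surjective)
  rw [(MonoidHom.ker_eq_bot_iff _).2 hinj]
  exact bot_le

end NormalTower

theorem mainTheorem8 {Γ G : Type u} [Group Γ] [Group G] [Finite Γ] [Finite G] (φ : Γ →* G)
    (hperf : Group.IsPerfect G)
    (hgen : Subgroup.normalClosure (Set.range φ) = ⊤) :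
    -- the three series involved terminate, so that their last terms make sense
    TerminatesAt (derivedSeries (normalTowerLimit φ)) (perfectCore (normalTowerLimit φ)) ∧
    TerminatesAt (Subgroup.upperCentralSeries (normalTowerLimit φ))
      (hypercenter (normalTowerLimit φ)) ∧
    TerminatesAt (Subgroup.lowerCentralSeries (⊤ : Subgroup Γ)) (gammaInfty Γ) ∧
    Group.IsPerfect (perfectCore (normalTowerLimit φ)) ∧
    IsCentralProduct (perfectCore (normalTowerLimit φ)) (hypercenter (normalTowerLimit φ)) ∧
    Group.IsNilpotent (Γ ⧸ gammaInfty Γ) ∧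
    Group.IsNilpotent (hypercenter (normalTowerLimit φ)) ∧
    ∀ c : ℕ, Group.nilpotencyClass (Γ ⧸ gammaInfty Γ) = c →
      Group.nilpotencyClass (hypercenter (normalTowerLimit φ)) ≤ c + 1 := by
  have := hperf
  obtain ⟨hfin, ψ, hψ⟩ := normalTowerLimit_isHypercentralOver hgen
  have hnil := isNilpotent_quotient_gammaInfty Γ
  refine ⟨TerminatesAt.iInf_of_antitone (derivedSeries_antitone _),
    TerminatesAt.iSup_of_monotone (Subgroup.upperCentralSeries_mono _),
    TerminatesAt.iInf_of_antitone (Subgroup.lowerCentralSeries_antitone _),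
    perfectCore_isPerfect, hψ.isCentralProduct, hnil, hψ.isNilpotent_hypercenter, ?_⟩
  rintro c rfl
  exact hψ.nilpotencyClass_hypercenter_le
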